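/- All graphs are finite and simple. A graph is \emph{chordal} if it has no induced cycle of length at least $4$, \emph{Hamiltonian} if it has a cycle through all its vertices, and \emph{cycle extendible} if for every non-Hamiltonian cycle $C$ there is a cycle $C'$ with $V(C)\subset V(C')$ and $|V(C')|=|V(C)|+1$. A tree $T$ is a \emph{decomposition tree} of a graph $G$ if there are (not necessarily distinct) nonempty subtrees $T_v$ of $T$, $v\in V(G)$, such that distinct vertices $v,w$ of $G$ are adjacent if and only if $T_v$ and $T_w$ have a common vertex. A \emph{leaf} of $T$ is a vertex of degree $1$; a \emph{branch vertex} is a vertex of degree at least $3$. For $k\ge 3$ let $G_k$ be the join of a complete graph on $\{x_1,\dots,x_k\}$ and a path with vertices, in order, $u_1,\dots,u_k,z,v_k,\dots,v_1$. Its heavy edges are $x_iu_i$ ($1\le i\le k$) and $x_iv_i$ ($1\le i\le k-1$). Pasting a clique onto a clique $Q$ of a graph means adding at least one new vertex and making the new vertices adjacent to each other and to exactly the vertices of $Q$ among the old ones. Let $\mathcal H_k$ be the family of graphs obtained from $G_k$ by pasting a distinct clique onto each heavy edge, and $\mathcal J_k$ the family of graphs obtained from $G_k$ by pasting a distinct clique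 onto each heavy edge and a further one onto the clique $\{x_1,\dots,x_k,z,v_k\}$. \textbf{Theorem.} For every $t\ge 5$ there is a connected Hamiltonian chordal graph $G$ that is not cycle extendible (hence a counterexample to Hendry's Conjecture that every Hamiltonian chordal graph is fully cycle extendible, that is, cycle extendible with every vertex in a triangle) and that has a decomposition tree with exactly $t$ leaves and exactly $t-2$ branch vertices. Moreover, $G$ can be taken in $\mathcal H_k$ if $t=2k-1$ is odd, and in $\mathcal J_k$ if $t=2k$ is even. -/

import Mathlib

namespace Hendry

open SimpleGraph

/-! ### Chordal and cycle extendible graphs -/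

/-- A graph is chordal if it has no induced cycle of length at least four. -/
def IsChordal {V : Type*} (G : SimpleGraph V) : Prop :=
  ∀ n : ℕ, 4 ≤ n → IsEmpty (cycleGraph n ↪g G)

/-- A graph is cycle extendible if for every non-Hamiltonian cycle `C` there is a cycle `C'` with
`V(C) ⊂ V(C')` and `|V(C')| = |V(C)| + 1`. -/
def IsCycleExtendible {V : Type*} [DecidableEq V] (G : SimpleGraph V) : Prop :=
  ∀ (a : V) (C : G.Walk a a), C.IsCycle → ¬ C.IsHamiltonianCycle →
    ∃ (b : V) (C' : G.Walk b b), C'.IsCycle ∧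
      C.support.toFinset ⊂ C'.support.toFinset ∧
      C'.support.toFinset.card = C.support.toFinset.card + 1

/-! ### Decomposition trees -/

/-- `T` is a decomposition tree of `G`: it is a tree, and `G` is the intersection graph of a family
of subtrees of `T`, indexed by the vertices of `G`. A subtree of a tree is determined by its vertex
set, which is any nonempty set of vertices inducing a connected subgraph. -/
def IsDecompositionTree {V W : Type*} (G : SimpleGraph V) (T : SimpleGraph W) : Prop :=
  T.IsTree ∧ ∃ S : V → Set W,
    (∀ v, (T.induce (S v)).Connected) ∧
    ∀ u v, G.Adj u v ↔ u ≠ v ∧ (S u ∩ S v).Nonempty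

/-- The leaves of a (finite) tree: its vertices of degree one. -/
def leaves {W : Type*} (T : SimpleGraph W) : Set W :=
  {w | (T.neighborSet w).ncard = 1}

/-- The branch vertices of a (finite) tree: its vertices of degree at least three. -/
def branchVertices {W : Type*} (T : SimpleGraph W) : Set W :=
  {w | 3 ≤ (T.neighborSet w).ncard}

/-! ### Joins and pasting of cliques -/

/-- The join of two disjoint graphs. -/
def join {V W : Type*} (G : SimpleGraph V) (H : SimpleGraph W) : SimpleGraph (V ⊕ W) :=
  (G ⊕g H) ⊔ completeBipartiteGraph V W

/-- Adjacency in the graph obtained from `G` by adding, for each `i`, the vertices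
`(i, 0), …, (i, m i - 1)`, and making them adjacent to each other and to all of `Q i`. -/
def pasteAdj {V ι : Type*} (G : SimpleGraph V) (Q : ι → Set V) (m : ι → ℕ) :
    V ⊕ (Σ i, Fin (m i)) → V ⊕ (Σ i, Fin (m i)) → Prop
  | .inl u, .inl v => G.Adj u v
  | .inl u, .inr p => u ∈ Q p.1
  | .inr p, .inl v => v ∈ Q p.1
  | .inr p, .inr q => p ≠ q ∧ p.1 = q.1

/-- Pasting onto each clique `Q i` of `G` a distinct clique of order `|Q i| + m i` (so that `m i` is
the number of its vertices outside `G`). -/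
def paste {V ι : Type*} (G : SimpleGraph V) (Q : ι → Set V) (m : ι → ℕ) :
    SimpleGraph (V ⊕ (Σ i, Fin (m i))) where
  Adj := pasteAdj G Q m
  symm := ⟨by
    rintro (u | p) (v | q) h
    · exact (G.adj_comm u v).1 h
    · exact h
    · exact h
    · exact ⟨h.1.symm, h.2.symm⟩⟩
  loopless := ⟨by
    rintro (u | p) h
    · exact G.loopless.irrefl u h
    · exact h.1 rfl⟩

/-! ### The base graph and the two families -/

/-- The vertices of the base graph: `k` vertices for the complete graph `K_k` and
`2k + 1` vertices for the path `P_{2k+1}`. -/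
abbrev BaseVertex (k : ℕ) : Type := Fin k ⊕ Fin (2 * k + 1)

/-- The base graph `G_k = K_k ∨ P_{2k+1}`. -/
def baseGraph (k : ℕ) : SimpleGraph (BaseVertex k) :=
  join (⊤ : SimpleGraph (Fin k)) (pathGraph (2 * k + 1))

/-- The vertex `x_{i+1}` of the complete graph. -/
def x {k : ℕ} (i : Fin k) : BaseVertex k := .inl i

/- The vertices of the path are, in order, `u_1, …, u_k, z, v_k, …, v_1`. -/

/-- The path vertex `u_{i+1}`. -/
def u {k : ℕ} (i : Fin k) : BaseVertex k := .inr ⟨i, by omega⟩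

/-- The middle vertex `z` of the path. -/
def z (k : ℕ) : BaseVertex k := .inr ⟨k, by omega⟩

/-- The path vertex `v_{i+1}`. -/
def v {k : ℕ} (i : Fin k) : BaseVertex k := .inr ⟨2 * k - i, by omega⟩

/-- The set of heavy edges `{x_i u_i : 1 ≤ i ≤ k} ∪ {x_i v_i : 1 ≤ i ≤ k - 1}`. -/
def heavyEdges (k : ℕ) : Set (Sym2 (BaseVertex k)) :=
  {e | ∃ i : Fin k, e = s(x i, u i)} ∪ {e | ∃ i : Fin k, (i : ℕ) + 1 < k ∧ e = s(x i, v i)}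

/-- The two ends of a heavy edge. -/
def heavyEnds (k : ℕ) (e : heavyEdges k) : Set (BaseVertex k) := {a | a ∈ e.1}

/-- The clique `{x_1, …, x_k, z, v_k}` of the base graph. -/
def centralClique (k : ℕ) : Set (BaseVertex k) :=
  Set.range x ∪ {z k} ∪ {a | ∃ i : Fin k, (i : ℕ) + 1 = k ∧ a = v i}

/-- Membership, up to isomorphism, in the family `H_k` of all graphs obtained from `G_k` by pasting
a distinct clique (with at least one new vertex) onto each heavy edge. -/
def InFamilyH (k : ℕ) {V : Type*} (G : SimpleGraph V) : Prop :=
  ∃ m : heavyEdges k → ℕ, (∀ e, 1 ≤ m e) ∧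
    Nonempty (G ≃g paste (baseGraph k) (heavyEnds k) m)

/-- Membership, up to isomorphism, in the family `J_k` of all graphs obtained from `G_k` by pasting
a distinct clique (with at least one new vertex) onto each heavy edge and onto the clique
`{x_1, …, x_k, z, v_k}`; the latter pasted clique thus has order at least `k + 3`. -/
def InFamilyJ (k : ℕ) {V : Type*} (G : SimpleGraph V) : Prop :=
  ∃ m : Option (heavyEdges k) → ℕ, (∀ e, 1 ≤ m e) ∧
    Nonempty (G ≃g paste (baseGraph k) (fun o => o.elim (centralClique k) (heavyEnds k)) m)

end Hendry

namespace Hendry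

open SimpleGraph

/-! ### General facts on graphs -/

/-! The counterexample pastes one vertex `W j` onto each heavy edge and, in the even case, one more,
`W k`, onto the central clique. A vertex pasted onto a heavy edge has degree two, so every cycle
through it uses both its edges. If a cycle contains all of these vertices, each `X i` with `i + 1 <
k` has both its cycle edges spent on pasted vertices, and `X (k - 1)` has only one edge to spare.

A snake that crosses from one side of the path to the other through `W`, `X i`, `W` sweeps up the
levels below `k - 1`, one after another, and ends at `X (k - 1)` (`exists_isPath_level_lt`).
Depending on the side from which it is entered, it closes up to a Hamiltonian cycle or to a cycle
`C` missing exactly `z`, `v_k` and `W k` (if present).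

An extension of `C` would add exactly one missing vertex `y`. The spare edge of `X (k - 1)` must go
to an end of the path, since otherwise the two lowest levels would be closed under cycle adjacency.
So `y` has no cycle neighbour among the `X i`, and without the other missing vertices it has at most
one other neighbour available: a contradiction (`not_exists_cycle`).

The decomposition tree is a caterpillar. Its spine vertex `j` stands for the clique formed by all `X
i` and the path edge `P j`, `P (j + 1)`; the leaf attached there, if any, stands for `W j` and its
clique. -/

/-- A graph is connected if every vertex except a root has a neighbour of smaller rank. -/
lemma connected_of_descent {α : Type*} {G : SimpleGraph α} (rank : α → ℕ) (r : α)
    (h : ∀ a, a ≠ r → ∃ b, G.Adj a b ∧ rank b < rank a) : G.Connected := by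
  refine (connected_iff_exists_forall_reachable G).2 ⟨r, fun a => ?_⟩
  induction hn : rank a using Nat.strong_induction_on generalizing a with
  | _ n ih =>
    by_cases har : a = r
    · subst har; exact Reachable.refl _
    · obtain ⟨b, hab, hb⟩ := h a har
      exact (ih (rank b) (hn ▸ hb) b rfl).trans hab.symm.reachable

/-- In a cycle, every vertex has a neighbour different from a given vertex. -/
lemma exists_toSubgraph_adj_ne {α : Type*} {G : SimpleGraph α} {a : α} {C : G.Walk a a}
    (hC : C.IsCycle) {b : α} (hb : b ∈ C.support) (c : α) :
    ∃ d, C.toSubgraph.Adj b d ∧ d ≠ c := by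
  have h2 := hC.ncard_neighborSet_toSubgraph_eq_two hb
  obtain ⟨d, hd, hdc⟩ := Set.exists_ne_of_one_lt_ncard (by rw [h2]; norm_num) c
  exact ⟨d, hd, hdc⟩

/-- If all the neighbours of a vertex on a cycle are among two vertices, they are these two. -/
lemma toSubgraph_adj_of_subset_pair {α : Type*} {G : SimpleGraph α} {a : α} {C : G.Walk a a}
    (hC : C.IsCycle) {b c d : α} (hb : b ∈ C.support)
    (h : ∀ e, C.toSubgraph.Adj b e → e = c ∨ e = d) :
    C.toSubgraph.Adj b c ∧ C.toSubgraph.Adj b d := by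
  obtain ⟨e, he, hed⟩ := exists_toSubgraph_adj_ne hC hb d
  obtain ⟨f, hf, hfc⟩ := exists_toSubgraph_adj_ne hC hb c
  exact ⟨(h e he).resolve_right hed ▸ he, (h f hf).resolve_left hfc ▸ hf⟩

/-- A vertex of a cycle has no third neighbour on it. -/
lemma toSubgraph_adj_eq_or_eq {α : Type*} {G : SimpleGraph α} {a : α} {C : G.Walk a a}
    (hC : C.IsCycle) {b c d e : α} (hc : C.toSubgraph.Adj b c) (hd : C.toSubgraph.Adj b d)
    (hcd : c ≠ d) (he : C.toSubgraph.Adj b e) : e = c ∨ e = d := by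
  have hb : b ∈ C.support := (C.mem_verts_toSubgraph).1 hc.fst_mem
  have h2 := hC.ncard_neighborSet_toSubgraph_eq_two hb
  have hfin : (C.toSubgraph.neighborSet b).Finite := Set.finite_of_ncard_ne_zero (by omega)
  have hsub : ({c, d} : Set α) ⊆ C.toSubgraph.neighborSet b := by
    rintro f (rfl | rfl)
    · exact hc
    · exact hd
  have heq := Set.eq_of_subset_of_ncard_le hsub (by rw [h2, Set.ncard_pair hcd]) hfin
  have : e ∈ ({c, d} : Set α) := heq ▸ he
  simpa using this

/-- A set of vertices closed under adjacency in a walk contains all its vertices if it contains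
one. -/
lemma mem_of_toSubgraph_closed {α : Type*} {G : SimpleGraph α} {a b : α} (p : G.Walk a b)
    (A : Set α) (hA : ∀ c d, p.toSubgraph.Adj c d → c ∈ A → d ∈ A) {c d : α}
    (hc : c ∈ p.support) (hcA : c ∈ A) (hd : d ∈ p.support) : d ∈ A := by
  have hconn := (Subgraph.connected_iff'.1 p.toSubgraph_connected).preconnected
    ⟨c, (p.mem_verts_toSubgraph).2 hc⟩ ⟨d, (p.mem_verts_toSubgraph).2 hd⟩
  obtain ⟨q⟩ := hconn
  have key : ∀ (e f : p.toSubgraph.verts) (_ : p.toSubgraph.coe.Walk e f), e.1 ∈ A → f.1 ∈ A := by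
    intro e f q
    induction q with
    | nil => exact id
    | cons h _ ih => exact fun he => ih (hA _ _ h he)
  exact key _ _ q hcA

/-- A graph is acyclic if, for some ranking in which adjacent vertices have different ranks, every
vertex has at most one neighbour of smaller rank. -/
lemma isAcyclic_of_rank {α : Type*} {G : SimpleGraph α} (rank : α → ℕ)
    (hne : ∀ a b, G.Adj a b → rank a ≠ rank b)
    (h : ∀ a b c, G.Adj a b → G.Adj a c → rank b < rank a → rank c < rank a → b = c) :
    G.IsAcyclic := by
  classical
  intro v C hC
  -- A vertex of largest rank on a cycle would have two distinct neighbours of smaller rank.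
  obtain ⟨a, ha, hmax⟩ := C.support.toFinset.exists_max_image rank ⟨v, by simp⟩
  rw [List.mem_toFinset] at ha
  obtain ⟨b, hab, -⟩ := exists_toSubgraph_adj_ne hC ha a
  obtain ⟨c, hac, hcb⟩ := exists_toSubgraph_adj_ne hC ha b
  have hlt : ∀ d, C.toSubgraph.Adj a d → rank d < rank a := fun d hd =>
    lt_of_le_of_ne (hmax d (by simpa using (C.mem_verts_toSubgraph).1 hd.snd_mem))
      (hne a d hd.adj_sub).symm
  exact hcb (h a c b hac.adj_sub hab.adj_sub (hlt c hac) (hlt b hab))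

/-- A graph with a perfect elimination ordering is chordal. -/
lemma isChordal_of_rank {α : Type*} {G : SimpleGraph α} (rank : α → ℕ)
    (hinj : Function.Injective rank)
    (h : ∀ a b c, G.Adj a b → G.Adj a c → rank b < rank a → rank c < rank a → b ≠ c →
      G.Adj b c) : IsChordal G := by
  intro n hn
  obtain ⟨n, rfl⟩ : ∃ m, n = m + 4 := ⟨n - 4, by omega⟩
  refine ⟨fun f => ?_⟩
  -- The two cycle neighbours of the top-ranked vertex are adjacent by hypothesis. They differ by
  -- two in the cycle, so adjacency would force `1 = 0` or `3 = 0` modulo the length.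
  obtain ⟨i, -, hmax⟩ := (Finset.univ : Finset (Fin (n + 4))).exists_max_image
    (fun i => rank (f i)) ⟨0, Finset.mem_univ _⟩
  have hlt : ∀ j, j ≠ i → rank (f j) < rank (f i) := fun j hj =>
    lt_of_le_of_ne (hmax j (Finset.mem_univ _)) fun e => hj (f.injective (hinj e))
  have h1 : (cycleGraph (n + 4)).Adj i (i + 1) := cycleGraph_adj.2 (Or.inr (by simp))
  have h2 : (cycleGraph (n + 4)).Adj i (i - 1) := cycleGraph_adj.2 (Or.inl (by simp))
  have hone : ((1 : Fin (n + 4)) : ℕ) = 1 := rfl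
  have htwo : ((1 + 1 : Fin (n + 4)) : ℕ) = 2 := by
    rw [Fin.val_add, hone, Nat.mod_eq_of_lt (by omega)]
  have hthree : ((1 + 1 + 1 : Fin (n + 4)) : ℕ) = 3 := by
    rw [Fin.val_add, hone, htwo, Nat.mod_eq_of_lt (by omega)]
  have hzero : ∀ j : Fin (n + 4), (j : ℕ) ≠ 0 → j ≠ 0 := fun j hj e => hj (by rw [e]; rfl)
  have h3 : i + 1 ≠ i - 1 := by
    intro e
    have h : (1 + 1 : Fin (n + 4)) = (i + 1) - (i - 1) := by abel
    exact hzero (1 + 1) (by omega) (by rw [h, e, sub_self])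
  have h4 := f.map_adj_iff.1 (h (f i) (f (i + 1)) (f (i - 1)) (f.map_adj_iff.2 h1)
    (f.map_adj_iff.2 h2) (hlt _ h1.ne') (hlt _ h2.ne') (fun e => h3 (f.injective e)))
  rcases cycleGraph_adj.1 h4 with e | e
  · have h : (1 : Fin (n + 4)) = (i + 1 - (i - 1)) - 1 := by abel
    exact hzero 1 (by omega) (by rw [h, e, sub_self])
  · have h : (1 + 1 + 1 : Fin (n + 4)) = 1 - (i - 1 - (i + 1)) := by abel
    exact hzero (1 + 1 + 1) (by omega) (by rw [h, e, sub_self])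

/-- Closing a path of length at least two gives a cycle. -/
lemma isCycle_cons_of_isPath {α : Type*} {G : SimpleGraph α} {a b : α} {p : G.Walk a b}
    (hp : p.IsPath) (hl : p.length ≠ 1) (h : G.Adj b a) : (Walk.cons h p).IsCycle :=
  (Walk.cons_isCycle_iff p h).2
    ⟨hp, fun he => hl (hp.length_eq_one_of_mem_edges (Sym2.eq_swap ▸ he))⟩

/-- Pasting single vertices along equally indexed sets gives isomorphic graphs. -/
def pasteIso {V ι ι' : Type*} (G : SimpleGraph V) {Q : ι → Set V} {Q' : ι' → Set V} (e : ι ≃ ι')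
    (h : ∀ i, Q i = Q' (e i)) : paste G Q (fun _ => 1) ≃g paste G Q' (fun _ => 1) where
  toEquiv := Equiv.sumCongr (Equiv.refl V) (Equiv.sigmaCongr e fun _ => Equiv.refl _)
  map_rel_iff' := by
    rintro (a | ⟨i, p⟩) (b | ⟨j, q⟩)
    · exact Iff.rfl
    · change a ∈ Q' (e j) ↔ a ∈ Q j
      rw [h]
    · change b ∈ Q' (e i) ↔ b ∈ Q i
      rw [h]
    · change ((⟨e i, p⟩ : Σ _ : ι', Fin 1) ≠ ⟨e j, q⟩ ∧ e i = e j) ↔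
        ((⟨i, p⟩ : Σ _ : ι, Fin 1) ≠ ⟨j, q⟩ ∧ i = j)
      simp [Sigma.ext_iff]

/-! ### The caterpillar tree -/

/-- The tree obtained from a path on `n` vertices by attaching a leaf to every vertex
satisfying `A`. -/
def caterpillar (n : ℕ) (A : Fin n → Prop) : SimpleGraph (Fin n ⊕ {j : Fin n // A j}) where
  Adj
    | .inl i, .inl j => (i : ℕ) + 1 = j ∨ (j : ℕ) + 1 = i
    | .inl i, .inr j => i = j.1
    | .inr i, .inl j => i.1 = j
    | .inr _, .inr _ => False
  symm := ⟨by
    rintro (i | i) (j | j) h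
    · exact h.symm
    · exact h.symm
    · exact h.symm
    · exact h⟩
  loopless := ⟨by
    rintro (i | i) h
    · simp at h
    · exact h⟩

/-- The position of a vertex of the caterpillar: the path first, then the attached leaves. -/
def caterpillarRank {n : ℕ} {A : Fin n → Prop} : Fin n ⊕ {j : Fin n // A j} → ℕ
  | .inl i => i
  | .inr j => n + j.1

variable {n : ℕ} {A : Fin n → Prop}

lemma caterpillar_adj_inl_inl {i j : Fin n} :
    (caterpillar n A).Adj (.inl i) (.inl j) ↔ (i : ℕ) + 1 = j ∨ (j : ℕ) + 1 = i := Iff.rfl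

lemma caterpillar_adj_inl_inr {i : Fin n} {j : {j : Fin n // A j}} :
    (caterpillar n A).Adj (.inl i) (.inr j) ↔ i = j.1 := Iff.rfl

lemma caterpillar_adj_inr_inl {i : {j : Fin n // A j}} {j : Fin n} :
    (caterpillar n A).Adj (.inr i) (.inl j) ↔ i.1 = j := Iff.rfl

lemma caterpillar_adj_inr_inr {i j : {j : Fin n // A j}} :
    ¬ (caterpillar n A).Adj (.inr i) (.inr j) := id

/-- A set of vertices of a caterpillar consisting of an interval of the path and of some leaves
attached to it induces a connected subgraph. -/
lemma caterpillar_induce_connected {S : Set (Fin n ⊕ {j : Fin n // A j})} (r : Fin n)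
    (hr : .inl r ∈ S) (hpath : ∀ i, .inl i ∈ S → i ≠ r → ∃ j : Fin n, .inl j ∈ S ∧ (j : ℕ) + 1 = i)
    (hleaf : ∀ j : {j : Fin n // A j}, .inr j ∈ S → .inl j.1 ∈ S) : ((caterpillar n A).induce S).Connected := by
  refine connected_of_descent (fun a => caterpillarRank a.1) ⟨.inl r, hr⟩ ?_
  rintro ⟨i | j, ha⟩ hne
  · obtain ⟨j, hj, hji⟩ := hpath i ha (by rintro rfl; exact hne rfl)
    refine ⟨⟨.inl j, hj⟩, ?_, ?_⟩
    · exact (caterpillar_adj_inl_inl (A := A)).2 (Or.inr hji)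
    · simp only [caterpillarRank]; omega
  · refine ⟨⟨.inl j.1, hleaf j ha⟩, ?_, ?_⟩
    · exact caterpillar_adj_inr_inl.2 rfl
    · simp only [caterpillarRank]; omega

lemma caterpillar_isTree (hn : 0 < n) : (caterpillar n A).IsTree where
  connected := by
    refine connected_of_descent caterpillarRank (.inl ⟨0, hn⟩) ?_
    rintro (i | j) hne
    · have hi : (i : ℕ) ≠ 0 := fun h => hne (congrArg Sum.inl (Fin.ext h))
      refine ⟨.inl ⟨i - 1, by omega⟩, caterpillar_adj_inl_inl.2 (Or.inr ?_), ?_⟩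
      · simp only; omega
      · simp only [caterpillarRank]; omega
    · refine ⟨.inl j.1, caterpillar_adj_inr_inl.2 rfl, ?_⟩
      simp only [caterpillarRank]; omega
  isAcyclic := by
    refine isAcyclic_of_rank caterpillarRank ?_ ?_
    · rintro (i | i) (j | j) h
      · simp only [caterpillar_adj_inl_inl, caterpillarRank] at *; omega
      · simp only [caterpillarRank]; omega
      · simp only [caterpillarRank]; omega
      · exact absurd h caterpillar_adj_inr_inr
    · rintro (i | i) (j | j) (l | l) h h' hlt hlt'
      · simp only [caterpillar_adj_inl_inl, caterpillarRank] at *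
        exact congrArg Sum.inl (Fin.ext (by omega))
      · simp only [caterpillarRank] at *; omega
      · simp only [caterpillarRank] at *; omega
      · simp only [caterpillarRank] at *; omega
      · simp only [caterpillar_adj_inr_inl] at *; rw [← h, h']
      · exact absurd h' caterpillar_adj_inr_inr
      · exact absurd h caterpillar_adj_inr_inr
      · exact absurd h caterpillar_adj_inr_inr

lemma caterpillar_neighborSet_inr (j : {j : Fin n // A j}) :
    (caterpillar n A).neighborSet (.inr j) = {.inl j.1} := by
  ext (i | i)
  · simp only [mem_neighborSet, caterpillar_adj_inr_inl, Set.mem_singleton_iff, Sum.inl.injEq]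
    exact eq_comm
  · simp [caterpillar_adj_inr_inr]

/-- If leaves are attached to both ends of the path, the attached leaves are all the leaves. -/
lemma caterpillar_leaves (hn : 2 ≤ n) (h0 : A ⟨0, by omega⟩) (h1 : A ⟨n - 1, by omega⟩) :
    leaves (caterpillar n A) = Set.range Sum.inr := by
  ext (i | j)
  · simp only [leaves, Set.mem_ofPred_eq, Set.mem_range, reduceCtorEq, exists_false, iff_false]
    intro h
    obtain ⟨a, ha⟩ := Set.ncard_eq_one.1 h
    have key : ∀ b c, (caterpillar n A).Adj (.inl i) b → (caterpillar n A).Adj (.inl i) c →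
        b = c := by
      intro b c hb hc
      have hb' : b ∈ ({a} : Set _) := ha ▸ hb
      have hc' : c ∈ ({a} : Set _) := ha ▸ hc
      rw [hb', hc']
    by_cases hi0 : (i : ℕ) = 0
    · have := key (.inl ⟨1, by omega⟩) (.inr ⟨⟨0, by omega⟩, h0⟩)
        (caterpillar_adj_inl_inl.2 (by simp [hi0])) (caterpillar_adj_inl_inr.2 (Fin.ext hi0))
      simp at this
    · by_cases hi1 : (i : ℕ) = n - 1
      · have := key (.inl ⟨n - 2, by omega⟩) (.inr ⟨⟨n - 1, by omega⟩, h1⟩)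
          (caterpillar_adj_inl_inl.2 (by simp only; omega)) (caterpillar_adj_inl_inr.2 (Fin.ext hi1))
        simp at this
      · have := key (.inl ⟨i - 1, by omega⟩) (.inl ⟨i + 1, by omega⟩)
          (caterpillar_adj_inl_inl.2 (by simp only; omega))
          (caterpillar_adj_inl_inl.2 (Or.inl rfl))
        simp at this
  · simp [leaves, caterpillar_neighborSet_inr]

/-- The branch vertices of a caterpillar are the inner vertices of the path with a leaf. -/
lemma caterpillar_branchVertices :
    branchVertices (caterpillar n A) =
      Sum.inl '' {i : Fin n | (i : ℕ) ≠ 0 ∧ (i : ℕ) ≠ n - 1 ∧ A i} := by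
  ext (i | j)
  · simp only [branchVertices, Set.mem_ofPred_eq, Set.mem_image, Sum.inl.injEq, exists_eq_right]
    constructor
    · intro h
      by_contra hcon
      have key : ∀ a b, (caterpillar n A).neighborSet (.inl i) ⊆ {a, b} → False := by
        intro a b hab
        have := (Set.ncard_le_ncard hab).trans (Set.ncard_insert_le a {b})
        rw [Set.ncard_singleton] at this
        omega
      by_cases hA : A i
      · by_cases hi0 : (i : ℕ) = 0
        · by_cases hi1 : (i : ℕ) = n - 1
          · apply key (.inr ⟨i, hA⟩) (.inr ⟨i, hA⟩)
            rintro (l | l) hl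
            · rw [mem_neighborSet, caterpillar_adj_inl_inl] at hl
              omega
            · rw [mem_neighborSet, caterpillar_adj_inl_inr] at hl
              subst hl; simp
          · apply key (.inl ⟨i + 1, by omega⟩) (.inr ⟨i, hA⟩)
            rintro (l | l) hl
            · rw [mem_neighborSet, caterpillar_adj_inl_inl] at hl
              left; exact congrArg Sum.inl (Fin.ext (by simp only; omega))
            · rw [mem_neighborSet, caterpillar_adj_inl_inr] at hl
              subst hl; simp
        · have hi1 : (i : ℕ) = n - 1 := by
            by_contra hi1
            exact hcon ⟨hi0, hi1, hA⟩
          apply key (.inl ⟨i - 1, by omega⟩) (.inr ⟨i, hA⟩)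
          rintro (l | l) hl
          · rw [mem_neighborSet, caterpillar_adj_inl_inl] at hl
            left; exact congrArg Sum.inl (Fin.ext (by simp only; omega))
          · rw [mem_neighborSet, caterpillar_adj_inl_inr] at hl
            subst hl; simp
      -- With no leaf at `i`, only the two path neighbours remain. At the ends, truncation and `min`
      -- return `i` itself, which is harmless in an upper bound.
      · apply key (.inl ⟨i - 1, by omega⟩) (.inl ⟨min (i + 1) (n - 1), by omega⟩)
        rintro (l | l) hl
        · rw [mem_neighborSet, caterpillar_adj_inl_inl] at hl
          rcases hl with hl | hl
          · right; exact congrArg Sum.inl (Fin.ext (by simp only; omega))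
          · left; exact congrArg Sum.inl (Fin.ext (by simp only; omega))
        · rw [mem_neighborSet, caterpillar_adj_inl_inr] at hl
          exact absurd (hl ▸ l.2) hA
    · rintro ⟨hi0, hi1, hA⟩
      have : (caterpillar n A).neighborSet (.inl i) =
          {.inl ⟨i - 1, by omega⟩, .inl ⟨i + 1, by omega⟩, .inr ⟨i, hA⟩} := by
        ext (l | l)
        · simp only [mem_neighborSet, caterpillar_adj_inl_inl, Set.mem_insert_iff, Sum.inl.injEq,
            Set.mem_singleton_iff, reduceCtorEq, or_false, Fin.ext_iff]
          omega
        · simp only [mem_neighborSet, caterpillar_adj_inl_inr, Set.mem_insert_iff, Sum.inr.injEq,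
            Set.mem_singleton_iff, reduceCtorEq, false_or, Subtype.ext_iff]
          exact eq_comm
      rw [this, Set.ncard_insert_of_notMem, Set.ncard_pair]
      · simp
      · simp only [Set.mem_insert_iff, Sum.inl.injEq, Fin.mk.injEq, Set.mem_singleton_iff,
          reduceCtorEq, or_false]
        omega
  · simp [branchVertices, caterpillar_neighborSet_inr]

lemma caterpillar_ncard_leaves (hn : 2 ≤ n) (h0 : A ⟨0, by omega⟩) (h1 : A ⟨n - 1, by omega⟩) :
    (leaves (caterpillar n A)).ncard = {i | A i}.ncard := by
  rw [caterpillar_leaves hn h0 h1, ← Set.image_univ, Set.ncard_image_of_injective _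
    Sum.inr_injective, Set.ncard_univ]
  rfl

/-- Both ends of the spine carry a leaf but have degree only two, which accounts for the subtracted
2. -/
lemma caterpillar_ncard_branchVertices (hn : 2 ≤ n) (h0 : A ⟨0, by omega⟩)
    (h1 : A ⟨n - 1, by omega⟩) :
    (branchVertices (caterpillar n A)).ncard = {i | A i}.ncard - 2 := by
  have hs : ({⟨0, by omega⟩, ⟨n - 1, by omega⟩} : Set (Fin n)) ⊆ {i | A i} := by
    rintro i (rfl | rfl)
    · exact h0
    · exact h1
  have h2 : ({⟨0, by omega⟩, ⟨n - 1, by omega⟩} : Set (Fin n)).ncard = 2 := by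
    refine Set.ncard_pair fun e => ?_
    rw [Fin.mk.injEq] at e
    omega
  rw [caterpillar_branchVertices, Set.ncard_image_of_injective _ Sum.inl_injective, ← h2,
    ← Set.ncard_sdiff hs]
  congr 1
  ext i
  simp only [Set.mem_ofPred_eq, Set.mem_sdiff, Set.mem_insert_iff, Set.mem_singleton_iff,
    Fin.ext_iff]
  tauto

/-! ### The counterexamples -/

/-- Positions on the path `0, …, 2k - 1` at which a pasted vertex sits; the position `k` is used
for the vertex pasted onto the central clique, if there is one. -/
def Attached (k : ℕ) (ε : Bool) (j : Fin (2 * k)) : Prop := (j : ℕ) = k → ε = true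

instance (k : ℕ) (ε : Bool) : DecidablePred (Attached k ε) := fun j =>
  inferInstanceAs (Decidable ((j : ℕ) = k → ε = true))

/-- The clique onto which the `j`-th vertex is pasted: the heavy edge `x_{j+1} u_{j+1}` for `j < k`,
the central clique for `j = k`, and the heavy edge `x_{2k-j} v_{2k-j}` for `j > k`. -/
def pasteClique (k : ℕ) (j : Fin (2 * k)) : Set (BaseVertex k) :=
  {a | match a with
    | .inl i => (j : ℕ) = k ∨ ((j : ℕ) < k ∧ (i : ℕ) = j) ∨ (k < (j : ℕ) ∧ (i : ℕ) + j + 1 = 2 * k)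
    | .inr q => ((j : ℕ) < k ∧ (q : ℕ) = j) ∨ ((j : ℕ) = k ∧ ((q : ℕ) = k ∨ (q : ℕ) = k + 1)) ∨
        (k < (j : ℕ) ∧ (q : ℕ) = j + 1)}

/-- The vertices of the counterexample. -/
abbrev Vertex (k : ℕ) (ε : Bool) : Type :=
  BaseVertex k ⊕ (Σ _ : {j : Fin (2 * k) // Attached k ε j}, Fin 1)

/-- The base graph with a single vertex pasted onto each heavy edge and, if `ε` is true, onto the
central clique. -/
def pasted (k : ℕ) (ε : Bool) : SimpleGraph (Vertex k ε) :=
  paste (baseGraph k) (fun j : {j : Fin (2 * k) // Attached k ε j} => pasteClique k j.1) fun _ => 1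

/-- A vertex of the complete graph. -/
def X {k : ℕ} (ε : Bool) (i : ℕ) (hi : i < k) : Vertex k ε := .inl (.inl ⟨i, hi⟩)

/-- A vertex of the path. -/
def P {k : ℕ} (ε : Bool) (q : ℕ) (hq : q < 2 * k + 1) : Vertex k ε := .inl (.inr ⟨q, hq⟩)

/-- A pasted vertex. -/
def W {k : ℕ} {ε : Bool} (j : ℕ) (hj : j < 2 * k) (hA : j = k → ε = true) : Vertex k ε :=
  .inr ⟨⟨⟨j, hj⟩, hA⟩, 0⟩

variable {k : ℕ} {ε : Bool}

lemma vertex_cases (a : Vertex k ε) : (∃ i hi, a = X ε i hi) ∨ (∃ q hq, a = P ε q hq) ∨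
    ∃ j hj hA, a = W j hj hA := by
  rcases a with (⟨i, hi⟩ | ⟨q, hq⟩) | ⟨⟨⟨j, hj⟩, hA⟩, l⟩
  · exact Or.inl ⟨i, hi, rfl⟩
  · exact Or.inr (Or.inl ⟨q, hq, rfl⟩)
  · refine Or.inr (Or.inr ⟨j, hj, hA, ?_⟩)
    rw [Subsingleton.elim l 0]
    rfl

/-! ### Equality and adjacency of vertices in numerical coordinates -/

@[simp] lemma X_inj {i i' : ℕ} {hi : i < k} {hi' : i' < k} : X ε i hi = X ε i' hi' ↔ i = i' := by
  simp [X]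

@[simp] lemma P_inj {q q' : ℕ} {hq : q < 2 * k + 1} {hq' : q' < 2 * k + 1} :
    P ε q hq = P ε q' hq' ↔ q = q' := by
  simp [P]

@[simp] lemma W_inj {j j' : ℕ} {hj : j < 2 * k} {hj' : j' < 2 * k} {hA : j = k → ε = true}
    {hA' : j' = k → ε = true} : W j hj hA = W j' hj' hA' ↔ j = j' := by
  refine ⟨fun h => ?_, fun h => by subst h; rfl⟩
  simpa [W] using congrArg (Sum.elim (fun _ => 0) fun p => (p.1.1 : ℕ)) h

@[simp] lemma X_ne_P {i q : ℕ} {hi : i < k} {hq : q < 2 * k + 1} : X ε i hi ≠ P ε q hq := by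
  simp [X, P]

@[simp] lemma P_ne_X {i q : ℕ} {hi : i < k} {hq : q < 2 * k + 1} : P ε q hq ≠ X ε i hi := by
  simp [X, P]

@[simp] lemma X_ne_W {i j : ℕ} {hi : i < k} {hj : j < 2 * k} {hA : j = k → ε = true} :
    X ε i hi ≠ W j hj hA := by
  simp [X, W]

@[simp] lemma W_ne_X {i j : ℕ} {hi : i < k} {hj : j < 2 * k} {hA : j = k → ε = true} :
    W j hj hA ≠ X ε i hi := by
  simp [X, W]

@[simp] lemma P_ne_W {q j : ℕ} {hq : q < 2 * k + 1} {hj : j < 2 * k} {hA : j = k → ε = true} :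
    P ε q hq ≠ W j hj hA := by
  simp [P, W]

@[simp] lemma W_ne_P {q j : ℕ} {hq : q < 2 * k + 1} {hj : j < 2 * k} {hA : j = k → ε = true} :
    W j hj hA ≠ P ε q hq := by
  simp [P, W]

@[simp] lemma adj_X_X {i i' : ℕ} {hi : i < k} {hi' : i' < k} :
    (pasted k ε).Adj (X ε i hi) (X ε i' hi') ↔ i ≠ i' := by
  simp [pasted, paste, pasteAdj, baseGraph, join, X]

@[simp] lemma adj_X_P {i q : ℕ} {hi : i < k} {hq : q < 2 * k + 1} :
    (pasted k ε).Adj (X ε i hi) (P ε q hq) := by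
  simp [pasted, paste, pasteAdj, baseGraph, join, X, P]

@[simp] lemma adj_P_X {i q : ℕ} {hi : i < k} {hq : q < 2 * k + 1} :
    (pasted k ε).Adj (P ε q hq) (X ε i hi) := adj_X_P.symm

@[simp] lemma adj_P_P {q q' : ℕ} {hq : q < 2 * k + 1} {hq' : q' < 2 * k + 1} :
    (pasted k ε).Adj (P ε q hq) (P ε q' hq') ↔ q + 1 = q' ∨ q' + 1 = q := by
  simp [pasted, paste, pasteAdj, baseGraph, join, P, pathGraph_adj]

@[simp] lemma adj_X_W {i j : ℕ} {hi : i < k} {hj : j < 2 * k} {hA : j = k → ε = true} :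
    (pasted k ε).Adj (X ε i hi) (W j hj hA) ↔
      j = k ∨ (j < k ∧ i = j) ∨ (k < j ∧ i + j + 1 = 2 * k) := Iff.rfl

@[simp] lemma adj_W_X {i j : ℕ} {hi : i < k} {hj : j < 2 * k} {hA : j = k → ε = true} :
    (pasted k ε).Adj (W j hj hA) (X ε i hi) ↔
      j = k ∨ (j < k ∧ i = j) ∨ (k < j ∧ i + j + 1 = 2 * k) := Iff.rfl

@[simp] lemma adj_P_W {q j : ℕ} {hq : q < 2 * k + 1} {hj : j < 2 * k} {hA : j = k → ε = true} :
    (pasted k ε).Adj (P ε q hq) (W j hj hA) ↔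
      (j < k ∧ q = j) ∨ (j = k ∧ (q = k ∨ q = k + 1)) ∨ (k < j ∧ q = j + 1) := Iff.rfl

@[simp] lemma adj_W_P {q j : ℕ} {hq : q < 2 * k + 1} {hj : j < 2 * k} {hA : j = k → ε = true} :
    (pasted k ε).Adj (W j hj hA) (P ε q hq) ↔
      (j < k ∧ q = j) ∨ (j = k ∧ (q = k ∨ q = k + 1)) ∨ (k < j ∧ q = j + 1) := Iff.rfl

@[simp] lemma not_adj_W_W {j j' : ℕ} {hj : j < 2 * k} {hA : j = k → ε = true} {hj' : j' < 2 * k}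
    {hA' : j' = k → ε = true} : ¬ (pasted k ε).Adj (W j hj hA) (W j' hj' hA') := by
  simp [pasted, paste, pasteAdj, W]

/-! ### Chordality -/

/-- The position of a vertex in a perfect elimination ordering. -/
def eliminationRank : Vertex k ε → ℕ
  | .inl (.inl i) => i
  | .inl (.inr q) => k + q
  | .inr p => 3 * k + 1 + p.1.1

@[simp] lemma eliminationRank_X {i : ℕ} {hi : i < k} : eliminationRank (X ε i hi) = i := rfl

@[simp] lemma eliminationRank_P {q : ℕ} {hq : q < 2 * k + 1} :
    eliminationRank (P ε q hq) = k + q := rfl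

@[simp] lemma eliminationRank_W {j : ℕ} {hj : j < 2 * k} {hA : j = k → ε = true} :
    eliminationRank (W j hj hA) = 3 * k + 1 + j := rfl

/-- The earlier neighbours of `P q` are all the `X i` and at most `P (q - 1)`; those of a pasted
vertex form the clique it was pasted onto. -/
lemma pasted_isChordal : IsChordal (pasted k ε) := by
  refine isChordal_of_rank eliminationRank ?_ ?_
  · intro a b h
    obtain ⟨i, hi, rfl⟩ | ⟨i, hi, rfl⟩ | ⟨i, hi, hA, rfl⟩ := vertex_cases a <;>
    obtain ⟨j, hj, rfl⟩ | ⟨j, hj, rfl⟩ | ⟨j, hj, hA, rfl⟩ := vertex_cases b <;>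
    simp at h ⊢ <;> omega
  · intro a b c
    obtain ⟨i, hi, rfl⟩ | ⟨i, hi, rfl⟩ | ⟨i, hi, hA, rfl⟩ := vertex_cases a <;>
    obtain ⟨j, hj, rfl⟩ | ⟨j, hj, rfl⟩ | ⟨j, hj, hA, rfl⟩ := vertex_cases b <;>
    obtain ⟨l, hl, rfl⟩ | ⟨l, hl, rfl⟩ | ⟨l, hl, hA, rfl⟩ := vertex_cases c <;>
    simp <;> omega

/-! ### The decomposition tree -/

/-- The subtree of the caterpillar that represents a vertex. -/
def subtree : Vertex k ε → Set (Fin (2 * k) ⊕ {j : Fin (2 * k) // Attached k ε j})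
  | .inl (.inl i) => {b | match b with
    | .inl _ => True
    | .inr j => (.inl i) ∈ pasteClique k j.1}
  | .inl (.inr q) => {b | match b with
    | .inl j => (q : ℕ) = j ∨ (q : ℕ) = j + 1
    | .inr j => (.inr q) ∈ pasteClique k j.1}
  | .inr p => {.inr p.1}

@[simp] lemma inl_mem_subtree_X {i : ℕ} {hi : i < k} {j : Fin (2 * k)} :
    .inl j ∈ subtree (X ε i hi) := trivial

@[simp] lemma inr_mem_subtree_X {i : ℕ} {hi : i < k} {j : {j : Fin (2 * k) // Attached k ε j}} :
    .inr j ∈ subtree (X ε i hi) ↔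
      (j.1 : ℕ) = k ∨ ((j.1 : ℕ) < k ∧ i = j.1) ∨ (k < (j.1 : ℕ) ∧ i + j.1 + 1 = 2 * k) := Iff.rfl

@[simp] lemma inl_mem_subtree_P {q : ℕ} {hq : q < 2 * k + 1} {j : Fin (2 * k)} :
    .inl j ∈ subtree (P ε q hq) ↔ q = j ∨ q = j + 1 := Iff.rfl

@[simp] lemma inr_mem_subtree_P {q : ℕ} {hq : q < 2 * k + 1}
    {j : {j : Fin (2 * k) // Attached k ε j}} :
    .inr j ∈ subtree (P ε q hq) ↔ ((j.1 : ℕ) < k ∧ q = j.1) ∨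
      ((j.1 : ℕ) = k ∧ (q = k ∨ q = k + 1)) ∨ (k < (j.1 : ℕ) ∧ q = j.1 + 1) := Iff.rfl

@[simp] lemma inl_mem_subtree_W {j : ℕ} {hj : j < 2 * k} {hA : j = k → ε = true}
    {i : Fin (2 * k)} : .inl i ∉ subtree (W j hj hA) := by
  simp [subtree, W]

@[simp] lemma inr_mem_subtree_W {j : ℕ} {hj : j < 2 * k} {hA : j = k → ε = true}
    {i : {j : Fin (2 * k) // Attached k ε j}} :
    .inr i ∈ subtree (W j hj hA) ↔ (i.1 : ℕ) = j := by
  simp [subtree, W, Subtype.ext_iff, Fin.ext_iff]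

lemma subtree_connected (hk : 0 < k) (a : Vertex k ε) :
    ((caterpillar (2 * k) (Attached k ε)).induce (subtree a)).Connected := by
  obtain ⟨i, hi, rfl⟩ | ⟨q, hq, rfl⟩ | ⟨j, hj, hA, rfl⟩ := vertex_cases a
  · refine caterpillar_induce_connected ⟨0, by omega⟩ (by simp) (fun i _ hi => ?_) (by simp)
    refine ⟨⟨i - 1, by omega⟩, by simp, ?_⟩
    rw [Ne, Fin.ext_iff] at hi
    simp only at hi ⊢
    omega
  -- The spine part of the subtree of `P q` is `q - 1` and `q`, as far as these exist. For `q = 0`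
  -- the truncated `q - 1` is still the correct first vertex.
  · refine caterpillar_induce_connected ⟨q - 1, by omega⟩ (by simp; omega) (fun i hi hir => ?_) ?_
    · rw [Ne, Fin.ext_iff] at hir
      simp only [inl_mem_subtree_P] at hi hir
      exact ⟨⟨q - 1, by omega⟩, by simp; omega, by simp only; omega⟩
    · intro j hj
      simp only [inr_mem_subtree_P, inl_mem_subtree_P] at hj ⊢
      omega
  · refine connected_of_descent (fun _ => 0) ⟨.inr ⟨⟨j, hj⟩, hA⟩, by simp⟩ ?_
    rintro ⟨b, hb⟩ hne
    exact absurd (Subtype.ext (show b = .inr ⟨⟨j, hj⟩, hA⟩ from hb)) hne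

lemma adj_iff_subtree (hk : 0 < k) (a b : Vertex k ε) :
    (pasted k ε).Adj a b ↔ a ≠ b ∧ (subtree a ∩ subtree b).Nonempty := by
  have key : (subtree a ∩ subtree b).Nonempty ↔
      (∃ j : Fin (2 * k), .inl j ∈ subtree a ∧ .inl j ∈ subtree b) ∨
      ∃ j : {j : Fin (2 * k) // Attached k ε j}, .inr j ∈ subtree a ∧ .inr j ∈ subtree b := by
    constructor
    · rintro ⟨j | j, h⟩
      · exact Or.inl ⟨j, h⟩
      · exact Or.inr ⟨j, h⟩
    · rintro (⟨j, h⟩ | ⟨j, h⟩)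
      · exact ⟨_, h⟩
      · exact ⟨_, h⟩
  rw [key]
  obtain ⟨i, hi, rfl⟩ | ⟨i, hi, rfl⟩ | ⟨i, hi, hA, rfl⟩ := vertex_cases a <;>
  obtain ⟨j, hj, rfl⟩ | ⟨j, hj, rfl⟩ | ⟨j, hj, hA', rfl⟩ := vertex_cases b
  · simp only [adj_X_X, ne_eq, X_inj, inl_mem_subtree_X, and_self]
    exact ⟨fun h => ⟨h, Or.inl ⟨⟨0, by omega⟩, trivial⟩⟩, fun h => h.1⟩
  · simp only [adj_X_P, true_iff]
    exact ⟨X_ne_P, Or.inl ⟨⟨j - 1, by omega⟩, inl_mem_subtree_X, by simp; omega⟩⟩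
  · simp only [adj_X_W, inl_mem_subtree_W, inr_mem_subtree_W, inr_mem_subtree_X]
    refine ⟨fun h => ⟨X_ne_W, Or.inr ⟨⟨⟨j, hj⟩, hA'⟩, h, rfl⟩⟩, ?_⟩
    rintro ⟨-, ⟨l, -, h⟩ | ⟨l, h, rfl⟩⟩
    · exact h.elim
    · exact h
  · simp only [adj_P_X, true_iff]
    exact ⟨P_ne_X, Or.inl ⟨⟨i - 1, by omega⟩, by simp; omega, inl_mem_subtree_X⟩⟩
  · simp only [adj_P_P, inl_mem_subtree_P, inr_mem_subtree_P, ne_eq, P_inj]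
    constructor
    · intro h
      -- A path edge is represented by the spine vertex numbered by its smaller end.
      exact ⟨by omega, Or.inl ⟨⟨min i j, by omega⟩, by simp only; omega⟩⟩
    · rintro ⟨h, ⟨l, h'⟩ | ⟨l, h'⟩⟩ <;> omega
  · simp only [adj_P_W, inl_mem_subtree_W, inr_mem_subtree_W, inr_mem_subtree_P]
    refine ⟨fun h => ⟨P_ne_W, Or.inr ⟨⟨⟨j, hj⟩, hA'⟩, h, rfl⟩⟩, ?_⟩
    rintro ⟨-, ⟨l, -, h⟩ | ⟨l, h, rfl⟩⟩
    · exact h.elim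
    · exact h
  · simp only [adj_W_X, inl_mem_subtree_W, inr_mem_subtree_W, inr_mem_subtree_X]
    refine ⟨fun h => ⟨W_ne_X, Or.inr ⟨⟨⟨i, hi⟩, hA⟩, rfl, h⟩⟩, ?_⟩
    rintro ⟨-, ⟨l, h, -⟩ | ⟨l, rfl, h⟩⟩
    · exact h.elim
    · exact h
  · simp only [adj_W_P, inl_mem_subtree_W, inr_mem_subtree_W, inr_mem_subtree_P]
    refine ⟨fun h => ⟨W_ne_P, Or.inr ⟨⟨⟨i, hi⟩, hA⟩, rfl, h⟩⟩, ?_⟩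
    rintro ⟨-, ⟨l, h, -⟩ | ⟨l, rfl, h⟩⟩
    · exact h.elim
    · exact h
  · simp only [not_adj_W_W, inl_mem_subtree_W, inr_mem_subtree_W, false_iff, ne_eq, W_inj]
    rintro ⟨h, ⟨l, h', -⟩ | ⟨l, h1, h2⟩⟩
    · exact h'
    · exact h (h1.symm.trans h2)

lemma pasted_isDecompositionTree (hk : 0 < k) :
    IsDecompositionTree (pasted k ε) (caterpillar (2 * k) (Attached k ε)) :=
  ⟨caterpillar_isTree (by omega), subtree, subtree_connected hk, adj_iff_subtree hk⟩

lemma ncard_attached (hk : 0 < k) :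
    {j | Attached k ε j}.ncard = if ε then 2 * k else 2 * k - 1 := by
  cases ε
  · have : {j | Attached k false j} = Set.univ \ {⟨k, by omega⟩} := by
      ext j
      simp [Attached, Fin.ext_iff]
    rw [this, Set.ncard_sdiff_singleton_of_mem (Set.mem_univ _), Set.ncard_univ]
    simp
  · have : {j | Attached k true j} = Set.univ := by
      ext j
      simp [Attached]
    rw [this, Set.ncard_univ]
    simp

/-! ### Two long cycles -/

/-- The index of a vertex: `x_{i+1}`, `u_{i+1}`, `v_{i+1}` and the vertices pasted onto the heavy
edges `x_{i+1} u_{i+1}` and `x_{i+1} v_{i+1}` have index `i`. -/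
def level : Vertex k ε → ℕ
  | .inl (.inl i) => i
  | .inl (.inr q) => min q (2 * k - q)
  | .inr p => min p.1.1 (2 * k - 1 - p.1.1)

@[simp] lemma level_X {i : ℕ} {hi : i < k} : level (X ε i hi) = i := rfl

@[simp] lemma level_P {q : ℕ} {hq : q < 2 * k + 1} : level (P ε q hq) = min q (2 * k - q) := rfl

@[simp] lemma level_W {j : ℕ} {hj : j < 2 * k} {hA : j = k → ε = true} :
    level (W j hj hA) = min j (2 * k - 1 - j) := rfl

lemma exists_isPath_cons {α : Type*} {G : SimpleGraph α} {S : Set α} {a b c : α}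
    (h : ∃ p : G.Walk b c, p.IsPath ∧ ∀ d, d ∈ p.support ↔ d ∈ S) (hab : G.Adj a b)
    (ha : a ∉ S) : ∃ p : G.Walk a c, p.IsPath ∧ ∀ d, d ∈ p.support ↔ d ∈ insert a S := by
  obtain ⟨p, hp, hS⟩ := h
  exact ⟨.cons hab p, (Walk.cons_isPath_iff _ _).2 ⟨hp, (hS a).not.2 ha⟩, by simp [hS]⟩

/-- A path through the vertices of a given index can be prepended to a path, entering at either
side. -/
lemma exists_isPath_level_succ {i q q' j j' : ℕ} (hi : i + 1 < k) {b : Vertex k ε}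
    (hs : (q = i ∧ q' = 2 * k - i ∧ j = i ∧ j' = 2 * k - 1 - i) ∨
      (q = 2 * k - i ∧ q' = i ∧ j = 2 * k - 1 - i ∧ j' = i))
    (h : ∃ p : (pasted k ε).Walk b (X ε (k - 1) (by omega)), p.IsPath ∧
      ∀ d, d ∈ p.support ↔ d ∈ {d | d = X ε (k - 1) (by omega) ∨ level d < i})
    (hb : (pasted k ε).Adj (P ε q (by omega)) b) :
    ∃ p : (pasted k ε).Walk (P ε q' (by omega)) (X ε (k - 1) (by omega)), p.IsPath ∧
      ∀ d, d ∈ p.support ↔ d ∈ {d | d = X ε (k - 1) (by omega) ∨ level d < i + 1} := by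
  have h1 := exists_isPath_cons h hb (by simp; omega)
  have h2 := exists_isPath_cons (a := W j (by omega) (by omega)) h1 (by simp; omega)
    (by simp; omega)
  have h3 := exists_isPath_cons (a := X ε i (by omega)) h2 (by simp; omega) (by simp; omega)
  have h4 := exists_isPath_cons (a := W j' (by omega) (by omega)) h3 (by simp; omega)
    (by simp; omega)
  obtain ⟨p, hp, hS⟩ := exists_isPath_cons (a := P ε q' (by omega)) h4 (by simp; omega)
    (by simp; omega)
  refine ⟨p, hp, fun d => (hS d).trans ?_⟩
  obtain ⟨j, hj, rfl⟩ | ⟨j, hj, rfl⟩ | ⟨j, hj, hA, rfl⟩ := vertex_cases d <;> simp <;> omega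

lemma exists_isPath_level_lt {i q : ℕ} (hi : i + 1 < k) (hq : q = i ∨ q = 2 * k - i) :
    ∃ p : (pasted k ε).Walk (P ε q (by omega)) (X ε (k - 1) (by omega)), p.IsPath ∧
      ∀ d, d ∈ p.support ↔ d ∈ {d | d = X ε (k - 1) (by omega) ∨ level d < i + 1} := by
  induction i generalizing q with
  | zero =>
    -- No vertex has level below 0, so the snake starts from the trivial path at `X (k - 1)`, which
    -- is adjacent to both ends of the path.
    exact exists_isPath_level_succ (q := 2 * k - q) (j := if q = 0 then 2 * k - 1 else 0)
      (j' := if q = 0 then 0 else 2 * k - 1) hi (by split <;> omega)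
      ⟨.nil, by simp⟩ adj_P_X
  | succ i ih =>
    -- The crossing of level `i + 1` leaves on the side opposite to its entry, so the lower snake
    -- has to be entered on that opposite side.
    obtain ⟨q', hq'⟩ : ∃ q', (q' = i ∨ q' = 2 * k - i) ∧ (q = i + 1 → q' = 2 * k - i) ∧
        (q = 2 * k - (i + 1) → q' = i) := by
      rcases hq with h | h
      · exact ⟨2 * k - i, by omega⟩
      · exact ⟨i, by omega⟩
    refine exists_isPath_level_succ (q := 2 * k - q)
      (j := if q = i + 1 then 2 * k - 1 - q else i + 1)
      (j' := if q = i + 1 then q else 2 * k - 1 - (i + 1)) hi (by split <;> omega)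
      (ih (by omega) hq'.1) ?_
    simp only [adj_P_P]
    omega

/-- Entering the snake at `P (k + 2)`, on the `v` side, lets the middle of the path be traversed
down to `P (k - 1)`, with `W k` inserted between `P (k + 1)` and `P k` if it exists. The cycle
closes through `W (k - 1)`. -/
lemma pasted_isHamiltonian (hk : 3 ≤ k) [Fintype (Vertex k ε)] [DecidableEq (Vertex k ε)] :
    (pasted k ε).IsHamiltonian := by
  intro _
  have h := exists_isPath_level_lt (k := k) (ε := ε) (i := k - 2) (q := k + 2) (by omega)
    (by omega)
  have h1 := exists_isPath_cons (a := P ε (k + 1) (by omega)) h (by simp)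
    (by simp; omega)
  have h2 : ∃ p : (pasted k ε).Walk (P ε k (by omega)) (X ε (k - 1) (by omega)), p.IsPath ∧
      ∀ d, d ∈ p.support ↔ d ∈ {d | d ≠ P ε (k - 1) (by omega) ∧
        d ≠ W (k - 1) (by omega) (by omega)} := by
    cases ε
    · obtain ⟨p, hp, hS⟩ := exists_isPath_cons (a := P false k (by omega)) h1 (by simp)
        (by simp; omega)
      refine ⟨p, hp, fun d => (hS d).trans ?_⟩
      obtain ⟨j, hj, rfl⟩ | ⟨j, hj, rfl⟩ | ⟨j, hj, hA, rfl⟩ := vertex_cases d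
      · simp; omega
      · simp; omega
      · have : j ≠ k := fun h => Bool.false_ne_true (hA h)
        simp; omega
    · have h2 := exists_isPath_cons (a := W k (by omega) (by simp)) h1 (by simp)
        (by simp; omega)
      obtain ⟨p, hp, hS⟩ := exists_isPath_cons (a := P true k (by omega)) h2 (by simp)
        (by simp; omega)
      refine ⟨p, hp, fun d => (hS d).trans ?_⟩
      obtain ⟨j, hj, rfl⟩ | ⟨j, hj, rfl⟩ | ⟨j, hj, hA, rfl⟩ := vertex_cases d <;> simp <;> omega
  have h3 := exists_isPath_cons (a := P ε (k - 1) (by omega)) h2 (by simp; omega) (by simp)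
  obtain ⟨p, hp, hS⟩ := exists_isPath_cons (a := W (k - 1) (by omega) (by omega)) h3
    (by simp; omega) (by simp)
  have hall : ∀ d, d ∈ p.support := fun d => (hS d).2 (by
    by_cases h : d = W (k - 1) (by omega) (by omega)
    · exact Or.inl h
    · by_cases h' : d = P ε (k - 1) (by omega)
      · exact Or.inr (Or.inl h')
      · exact Or.inr (Or.inr ⟨h', h⟩))
  have hl : p.length ≠ 1 := by
    intro hl
    have h1 := List.toFinset_card_le p.support
    rw [Walk.length_support, hl] at h1
    have h2 : ({X ε 0 (by omega), X ε 1 (by omega), X ε 2 (by omega)} : Finset (Vertex k ε)) ⊆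
        p.support.toFinset := fun d _ => by simpa using hall d
    have h3 := Finset.card_le_card h2
    rw [Finset.card_eq_three.2 ⟨_, _, _, by simp, by simp, by simp, rfl⟩] at h3
    omega
  have hclose : (pasted k ε).Adj (X ε (k - 1) (by omega)) (W (k - 1) (by omega) (by omega)) := by
    simp; omega
  refine ⟨_, .cons hclose p, ?_⟩
  rw [Walk.isHamiltonianCycle_iff_isCycle_and_support_count_tail_eq_one]
  refine ⟨isCycle_cons_of_isPath hp hl _, fun d => ?_⟩
  rw [Walk.support_cons, List.tail_cons]
  exact hp.isHamiltonian_of_mem hall d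

/-- The cycle missing exactly `z`, `v_k` and the vertex pasted onto the central clique. -/
lemma exists_nonextendible_cycle (hk : 3 ≤ k) :
    ∃ (a : Vertex k ε) (C : (pasted k ε).Walk a a), C.IsCycle ∧
      ∀ d, d ∈ C.support ↔ d ≠ P ε k (by omega) ∧ d ≠ P ε (k + 1) (by omega) ∧
        ∀ h, d ≠ W k (by omega) h := by
  classical
  -- Entering on the `u` side instead connects directly to `P (k - 1)` and bypasses the middle.
  have h := exists_isPath_level_lt (k := k) (ε := ε) (i := k - 2) (q := k - 2) (by omega)
    (by omega)
  have h1 := exists_isPath_cons (a := P ε (k - 1) (by omega)) h (by simp; omega)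
    (by simp; omega)
  obtain ⟨p, hp, hS⟩ := exists_isPath_cons (a := W (k - 1) (by omega) (by omega)) h1
    (by simp; omega) (by simp; omega)
  have hl : p.length ≠ 1 := by
    intro hl
    have h1 := List.toFinset_card_le p.support
    rw [Walk.length_support, hl] at h1
    have h2 : ({X ε 0 (by omega), X ε 1 (by omega), P ε 0 (by omega)} : Finset (Vertex k ε)) ⊆
        p.support.toFinset := by
      intro d hd
      rw [List.mem_toFinset, hS]
      simp only [Finset.mem_insert, Finset.mem_singleton] at hd
      rcases hd with rfl | rfl | rfl <;> simp <;> omega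
    have h3 := Finset.card_le_card h2
    rw [Finset.card_eq_three.2 ⟨_, _, _, by simp, by simp, by simp, rfl⟩] at h3
    omega
  have hclose : (pasted k ε).Adj (X ε (k - 1) (by omega)) (W (k - 1) (by omega) (by omega)) := by
    simp; omega
  refine ⟨_, .cons hclose p, isCycle_cons_of_isPath hp hl _, fun d => ?_⟩
  rw [Walk.support_cons, List.mem_cons, hS]
  obtain ⟨j, hj, rfl⟩ | ⟨j, hj, rfl⟩ | ⟨j, hj, hA, rfl⟩ := vertex_cases d
  · simp; omega
  · simp; omega
  · have h : (∀ h, W j hj hA ≠ W k (by omega) h) ↔ j ≠ k :=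
      ⟨fun h => by rintro rfl; exact h hA rfl, fun h _ => by simpa using h⟩
    rw [h]
    simp; omega

/-! ### Non-extendibility -/

/-- No cycle contains exactly one of `z`, `v_k` and the vertex pasted onto the central clique, and
all the other vertices. -/
lemma not_exists_cycle (hk : 3 ≤ k) {a : Vertex k ε} {C : (pasted k ε).Walk a a} (hC : C.IsCycle)
    (hmem : ∀ d, d ≠ P ε k (by omega) → d ≠ P ε (k + 1) (by omega) →
      (∀ h, d ≠ W k (by omega) h) → d ∈ C.support)
    {y : Vertex k ε} (hy : y ∈ C.support)
    (hyc : y = P ε k (by omega) ∨ y = P ε (k + 1) (by omega) ∨ ∃ h, y = W k (by omega) h)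
    (huniq : ∀ d ∈ C.support, d = P ε k (by omega) ∨ d = P ε (k + 1) (by omega) ∨
      (∃ h, d = W k (by omega) h) → d = y) : False := by
  have hsup : ∀ {c d}, C.toSubgraph.Adj c d → d ∈ C.support := fun h =>
    (C.mem_verts_toSubgraph).1 h.snd_mem
  -- The pasted vertices of degree two force both their edges into the cycle; this saturates every
  -- `X i` except the last.
  have hWu : ∀ j (hj : j < k), C.toSubgraph.Adj (W j (by omega) (by omega)) (X ε j hj) ∧
      C.toSubgraph.Adj (W j (by omega) (by omega)) (P ε j (by omega)) := by
    intro j hj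
    refine toSubgraph_adj_of_subset_pair hC (hmem _ (by simp) (by simp) (by simp; omega)) ?_
    intro e he
    have he := he.adj_sub
    obtain ⟨l, hl, rfl⟩ | ⟨l, hl, rfl⟩ | ⟨l, hl, hA, rfl⟩ := vertex_cases e <;>
      simp at he ⊢ <;> omega
  have hWv : ∀ j (hj : k < j) (hj' : j < 2 * k),
      C.toSubgraph.Adj (W j (by omega) (by omega)) (X ε (2 * k - 1 - j) (by omega)) ∧
      C.toSubgraph.Adj (W j (by omega) (by omega)) (P ε (j + 1) (by omega)) := by
    intro j hj hj'
    refine toSubgraph_adj_of_subset_pair hC (hmem _ (by simp) (by simp) (by simp; omega)) ?_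
    intro e he
    have he := he.adj_sub
    obtain ⟨l, hl, rfl⟩ | ⟨l, hl, rfl⟩ | ⟨l, hl, hA, rfl⟩ := vertex_cases e <;>
      simp at he ⊢ <;> omega
  have hX : ∀ i (hi : i + 1 < k) e, C.toSubgraph.Adj (X ε i (by omega)) e →
      e = W i (by omega) (by omega) ∨ e = W (2 * k - 1 - i) (by omega) (by omega) := by
    intro i hi e he
    have h2 := (hWv (2 * k - 1 - i) (by omega) (by omega)).1.symm
    have hi' : 2 * k - 1 - (2 * k - 1 - i) = i := by omega
    simp only [hi'] at h2
    exact toSubgraph_adj_eq_or_eq hC (hWu i (by omega)).1.symm h2 (by simp; omega) he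
  -- One of the ends of the path is joined to the last vertex of the complete graph.
  have hend : C.toSubgraph.Adj (P ε 0 (by omega)) (X ε (k - 1) (by omega)) ∨
      C.toSubgraph.Adj (P ε (2 * k) (by omega)) (X ε (k - 1) (by omega)) := by
    -- If neither end of the path is joined to `X (k - 1)`, each must continue along the path,
    -- because the other `X i` are saturated. This also saturates `P 1` and `P (2 * k - 1)`, so the
    -- cycle cannot leave the levels 0 and 1.
    by_contra! hcon
    have hu0 : C.toSubgraph.Adj (P ε 0 (by omega)) (P ε 1 (by omega)) := by
      refine (toSubgraph_adj_of_subset_pair hC (c := W 0 (by omega) (by omega))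
        (hmem _ (by simp; omega) (by simp) (by simp)) ?_).2
      intro e he
      have hadj := he.adj_sub
      obtain ⟨l, hl, rfl⟩ | ⟨l, hl, rfl⟩ | ⟨l, hl, hA, rfl⟩ := vertex_cases e
      · by_cases hlk : l + 1 < k
        · have := hX l hlk _ he.symm
          simp at this
        · obtain rfl : l = k - 1 := by omega
          exact absurd he hcon.1
      · simp at hadj ⊢; omega
      · simp at hadj ⊢; omega
    have hv0 : C.toSubgraph.Adj (P ε (2 * k) (by omega)) (P ε (2 * k - 1) (by omega)) := by
      refine (toSubgraph_adj_of_subset_pair hC (c := W (2 * k - 1) (by omega) (by omega))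
        (hmem _ (by simp; omega) (by simp; omega) (by simp)) ?_).2
      intro e he
      have hadj := he.adj_sub
      obtain ⟨l, hl, rfl⟩ | ⟨l, hl, rfl⟩ | ⟨l, hl, hA, rfl⟩ := vertex_cases e
      · by_cases hlk : l + 1 < k
        · have := hX l hlk _ he.symm
          simp at this
        · obtain rfl : l = k - 1 := by omega
          exact absurd he hcon.2
      · simp at hadj ⊢; omega
      · simp at hadj ⊢; omega
    have hu1 := fun e => toSubgraph_adj_eq_or_eq hC (hWu 1 (by omega)).2.symm hu0.symm
      (by simp) (e := e)
    have hv1 : ∀ e, C.toSubgraph.Adj (P ε (2 * k - 1) (by omega)) e →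
        e = W (2 * k - 2) (by omega) (by omega) ∨ e = P ε (2 * k) (by omega) := by
      intro e he
      have h2 := (hWv (2 * k - 2) (by omega) (by omega)).2.symm
      have hi' : 2 * k - 2 + 1 = 2 * k - 1 := by omega
      simp only [hi'] at h2
      exact toSubgraph_adj_eq_or_eq hC h2 hv0.symm (by simp) he
    have hclosed : ∀ c d, C.toSubgraph.Adj c d → c ∈ {c : Vertex k ε | level c < 2} →
        d ∈ {c : Vertex k ε | level c < 2} := by
      intro c d h hc
      have hadj := h.adj_sub
      rw [Set.mem_ofPred_eq] at hc ⊢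
      obtain ⟨i, hi, rfl⟩ | ⟨q, hq, rfl⟩ | ⟨j, hj, hA, rfl⟩ := vertex_cases c
      · rw [level_X] at hc
        rcases hX i (by omega) d h with rfl | rfl <;> rw [level_W] <;> omega
      · rw [level_P] at hc
        by_cases h1 : q = 1
        · subst h1
          rcases hu1 d h with rfl | rfl <;> simp
        by_cases h1 : q = 2 * k - 1
        · subst h1
          rcases hv1 d h with rfl | rfl <;> simp <;> omega
        obtain ⟨l, hl, rfl⟩ | ⟨l, hl, rfl⟩ | ⟨l, hl, hA, rfl⟩ := vertex_cases d
        · by_cases hlk : l + 1 < k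
          · have := hX l hlk _ h.symm
            simp at this
          · obtain rfl : l = k - 1 := by omega
            obtain rfl | rfl : q = 0 ∨ q = 2 * k := by omega
            · exact absurd h hcon.1
            · exact absurd h hcon.2
        · simp at hadj ⊢; omega
        · simp at hadj ⊢; omega
      · rw [level_W] at hc
        obtain ⟨l, hl, rfl⟩ | ⟨l, hl, rfl⟩ | ⟨l, hl, hA, rfl⟩ := vertex_cases d <;>
          simp at hadj ⊢ <;> omega
    -- The vertex `X (k - 1)` is on the cycle and has level `k - 1`, which is at least 2 because `k
    -- ≥ 3`.
    have := mem_of_toSubgraph_closed C {c : Vertex k ε | level c < 2} hclosed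
      (c := X ε 0 (by omega)) (d := X ε (k - 1) (by omega)) (hmem _ (by simp) (by simp) (by simp))
      (by simp) (hmem _ (by simp) (by simp) (by simp))
    simp at this
    omega
  -- The two cycle edges of `X (k - 1)` are now known: one to `W (k - 1)`, one to an end of the
  -- path.
  have hlast : ∀ e, C.toSubgraph.Adj (X ε (k - 1) (by omega)) e →
      e = W (k - 1) (by omega) (by omega) ∨ e = P ε 0 (by omega) ∨ e = P ε (2 * k) (by omega) := by
    intro e he
    rcases hend with h | h <;>
    rcases toSubgraph_adj_eq_or_eq hC (hWu (k - 1) (by omega)).1.symm h.symm (by simp) he with h | h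
    · exact Or.inl h
    · exact Or.inr (Or.inl h)
    · exact Or.inl h
    · exact Or.inr (Or.inr h)
  have hyX : ∀ i hi, ¬ C.toSubgraph.Adj y (X ε i hi) := by
    intro i hi h
    by_cases hik : i + 1 < k
    · have := hX i hik y h.symm
      rcases hyc with rfl | rfl | ⟨_, rfl⟩ <;> simp at this; omega
    · obtain rfl : i = k - 1 := by omega
      have := hlast y h.symm
      rcases hyc with rfl | rfl | ⟨_, rfl⟩ <;> simp at this <;> omega
  have hyN : ∀ e, C.toSubgraph.Adj y e → e ≠ y ∧ e ≠ P ε k (by omega) ∧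
      e ≠ P ε (k + 1) (by omega) ∧ ∀ h, e ≠ W k (by omega) h := by
    intro e he
    have hne := he.adj_sub.ne'
    refine ⟨hne, fun h => hne (huniq e (hsup he) (Or.inl h)),
      fun h => hne (huniq e (hsup he) (Or.inr (Or.inl h))),
      fun hA h => hne (huniq e (hsup he) (Or.inr (Or.inr ⟨hA, h⟩)))⟩
  -- The only candidate neighbour left is `P (k - 1)` for `z` and `P (k + 2)` for `v_k`; for `W k`
  -- there is none, and the excluded vertex is immaterial. A second cycle neighbour cannot exist.
  obtain ⟨e, he, hne⟩ := exists_toSubgraph_adj_ne hC hy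
    (P ε (if y = P ε k (by omega) then k - 1 else k + 2) (by split <;> omega))
  have hadj := he.adj_sub
  obtain ⟨-, h1, h2, h3⟩ := hyN e he
  obtain ⟨l, hl, rfl⟩ | ⟨l, hl, rfl⟩ | ⟨l, hl, hA, rfl⟩ := vertex_cases e
  · exact hyX l hl he
  · rcases hyc with rfl | rfl | ⟨_, rfl⟩ <;> simp at hadj hne h1 h2 <;> omega
  · have hlk : l ≠ k := by
      rintro rfl
      exact h3 hA rfl
    rcases hyc with rfl | rfl | ⟨_, rfl⟩ <;> simp at hadj <;> omega

lemma pasted_not_isCycleExtendible (hk : 3 ≤ k) [DecidableEq (Vertex k ε)] :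
    ¬ IsCycleExtendible (pasted k ε) := by
  intro hext
  obtain ⟨a, C, hC, hmem⟩ := exists_nonextendible_cycle (ε := ε) hk
  obtain ⟨b, C', hC', hss, hcard⟩ := hext a C hC fun h =>
    ((hmem (P ε k (by omega))).1 (h.mem_support _)).1 rfl
  -- The inclusion and the cardinality together say that the extension adds a single vertex `y`.
  obtain ⟨y, hyC, hins⟩ := Finset.exists_eq_insert_iff.2 ⟨hss.subset, hcard.symm⟩
  have hC'mem : ∀ d, d ∈ C'.support ↔ d = y ∨ d ∈ C.support := fun d => by
    rw [← List.mem_toFinset, ← hins, Finset.mem_insert, List.mem_toFinset]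
  rw [List.mem_toFinset, hmem] at hyC
  refine not_exists_cycle hk hC' (y := y)
    (fun d h1 h2 h3 => (hC'mem d).2 (Or.inr ((hmem d).2 ⟨h1, h2, h3⟩)))
    ((hC'mem y).2 (Or.inl rfl)) (by grind) fun d hd hdc => ?_
  refine ((hC'mem d).1 hd).resolve_right fun h => ?_
  obtain ⟨h1, h2, h3⟩ := (hmem d).1 h
  rcases hdc with h | h | ⟨hA, h⟩
  · exact h1 h
  · exact h2 h
  · exact h3 hA h

/-! ### Membership in the two families -/

/-- The `j`-th heavy edge. -/
def heavyEdge (k : ℕ) (j : Fin (2 * k)) : Sym2 (BaseVertex k) :=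
  if h : (j : ℕ) < k then s(x ⟨j, h⟩, u ⟨j, h⟩)
  else s(x ⟨2 * k - 1 - j, by omega⟩, v ⟨2 * k - 1 - j, by omega⟩)

/-- The position `j = k` must be excluded: there the formula gives `x_k v_k`, which is not heavy. -/
lemma heavyEdge_mem {j : Fin (2 * k)} (hj : (j : ℕ) ≠ k) : heavyEdge k j ∈ heavyEdges k := by
  rw [heavyEdge]
  split
  · exact Or.inl ⟨_, rfl⟩
  · exact Or.inr ⟨_, by simp only; omega, rfl⟩

lemma heavyEdge_injective : Function.Injective (heavyEdge k) := by
  intro i j h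
  rw [Fin.ext_iff]
  unfold heavyEdge at h
  split at h <;> split at h <;> simp [x, u, v] at h <;> omega

lemma exists_heavyEdge_eq {e : Sym2 (BaseVertex k)} (he : e ∈ heavyEdges k) :
    ∃ j : Fin (2 * k), (j : ℕ) ≠ k ∧ heavyEdge k j = e := by
  obtain ⟨i, rfl⟩ | ⟨i, hi, rfl⟩ := he
  · refine ⟨⟨i, by omega⟩, by simp only; omega, ?_⟩
    rw [heavyEdge, dif_pos i.2]
  · refine ⟨⟨2 * k - 1 - i, by omega⟩, by simp only; omega, ?_⟩
    have h : 2 * k - 1 - (2 * k - 1 - (i : ℕ)) = i := by omega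
    rw [heavyEdge, dif_neg (by simp only; omega)]
    simp only [h]

lemma mem_heavyEdge_iff {j : Fin (2 * k)} (hj : (j : ℕ) ≠ k) (a : BaseVertex k) :
    a ∈ pasteClique k j ↔ a ∈ heavyEdge k j := by
  unfold heavyEdge pasteClique
  split <;> rcases a with a | a <;> simp [x, u, v, Fin.ext_iff] <;> omega

lemma mem_centralClique_iff (hk : 0 < k) {j : Fin (2 * k)} (hj : (j : ℕ) = k)
    (a : BaseVertex k) : a ∈ pasteClique k j ↔ a ∈ centralClique k := by
  unfold centralClique pasteClique
  rcases a with a | a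
  · simp [x, hj]
  · simp only [hj, Set.mem_ofPred_eq, lt_irrefl, false_and, true_and, false_or, or_false,
      Set.mem_union, Set.mem_range, Set.mem_singleton_iff, x, z, v, reduceCtorEq, exists_false,
      Sum.inr.injEq, Fin.ext_iff]
    constructor
    · rintro (h | h)
      · exact Or.inl h
      · exact Or.inr ⟨⟨k - 1, by omega⟩, by simp only; omega, by simp only; omega⟩
    · rintro (h | ⟨i, h, h'⟩) <;> omega

lemma pasted_inFamilyH : InFamilyH k (pasted k false) := by
  have hne : ∀ j : {j : Fin (2 * k) // Attached k false j}, (j.1 : ℕ) ≠ k :=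
    fun j h => Bool.false_ne_true (j.2 h)
  let f : {j : Fin (2 * k) // Attached k false j} → heavyEdges k :=
    fun j => ⟨heavyEdge k j.1, heavyEdge_mem (hne j)⟩
  have hf : Function.Bijective f := by
    constructor
    · intro i j h
      exact Subtype.ext (heavyEdge_injective (congrArg Subtype.val h))
    · rintro ⟨e, he⟩
      obtain ⟨j, hj, rfl⟩ := exists_heavyEdge_eq he
      exact ⟨⟨j, fun h => absurd h hj⟩, rfl⟩
  exact ⟨fun _ => 1, fun _ => le_rfl, ⟨pasteIso _ (Equiv.ofBijective f hf) fun j =>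
    Set.ext fun a => mem_heavyEdge_iff (hne j) a⟩⟩

lemma pasted_inFamilyJ (hk : 0 < k) : InFamilyJ k (pasted k true) := by
  let f : {j : Fin (2 * k) // Attached k true j} → Option (heavyEdges k) :=
    fun j => if h : (j.1 : ℕ) = k then none else some ⟨heavyEdge k j.1, heavyEdge_mem h⟩
  have hf : Function.Bijective f := by
    constructor
    · intro i j h
      refine Subtype.ext ?_
      by_cases hi : (i.1 : ℕ) = k <;> by_cases hj : (j.1 : ℕ) = k <;> simp [f, hi, hj] at h
      · exact Fin.ext (hi.trans hj.symm)
      · exact heavyEdge_injective h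
    · rintro (_ | ⟨e, he⟩)
      · exact ⟨⟨⟨k, by omega⟩, fun _ => rfl⟩, by simp [f]⟩
      · obtain ⟨j, hj, rfl⟩ := exists_heavyEdge_eq he
        exact ⟨⟨j, fun _ => rfl⟩, by simp [f, hj]⟩
  refine ⟨fun _ => 1, fun _ => le_rfl, ⟨pasteIso _ (Equiv.ofBijective f hf) fun j =>
    Set.ext fun a => ?_⟩⟩
  by_cases hj : (j.1 : ℕ) = k
  · simpa [f, hj] using mem_centralClique_iff hk hj a
  · simpa [f, hj, heavyEnds] using mem_heavyEdge_iff hj a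

/-! ### Counting leaves and branch vertices -/

lemma pasted_exists_decompositionTree (hk : 2 ≤ k) {t : ℕ}
    (ht : t = if ε then 2 * k else 2 * k - 1) :
    ∃ (B : Type) (_ : Fintype B) (T : SimpleGraph B), IsDecompositionTree (pasted k ε) T ∧
      (leaves T).ncard = t ∧ (branchVertices T).ncard = t - 2 := by
  have h0 : Attached k ε ⟨0, by omega⟩ := fun h => by simp only at h; omega
  have h1 : Attached k ε ⟨2 * k - 1, by omega⟩ := fun h => by simp only at h; omega
  refine ⟨_, inferInstance, _, pasted_isDecompositionTree (by omega), ?_, ?_⟩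
  · rw [caterpillar_ncard_leaves (by omega) h0 h1, ncard_attached (by omega), ht]
  · rw [caterpillar_ncard_branchVertices (by omega) h0 h1, ncard_attached (by omega), ht]

end Hendry

theorem mainTheorem5 (t : ℕ) (ht : 5 ≤ t) :
    ∃ (V : Type) (_ : Fintype V) (_ : DecidableEq V) (G : SimpleGraph V),
      G.Connected ∧ G.IsHamiltonian ∧ Hendry.IsChordal G ∧ ¬ Hendry.IsCycleExtendible G ∧
      (∃ (W : Type) (_ : Fintype W) (T : SimpleGraph W),
        Hendry.IsDecompositionTree G T ∧
        (Hendry.leaves T).ncard = t ∧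
        (Hendry.branchVertices T).ncard = t - 2) ∧
      (∀ k : ℕ, t = 2 * k - 1 → Hendry.InFamilyH k G) ∧
      (∀ k : ℕ, t = 2 * k → Hendry.InFamilyJ k G) := by
  -- The parity of `t` decides whether the central clique receives a pasted vertex; the membership
  -- claim for the other family is then vacuous.
  obtain ⟨k, rfl | rfl⟩ : ∃ k, t = 2 * k ∨ t = 2 * k - 1 := ⟨(t + 1) / 2, by omega⟩
  · have hk : 3 ≤ k := by omega
    have hham := Hendry.pasted_isHamiltonian (ε := true) hk
    refine ⟨_, inferInstance, inferInstance, Hendry.pasted k true, hham.connected, hham,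
      Hendry.pasted_isChordal, Hendry.pasted_not_isCycleExtendible hk,
      Hendry.pasted_exists_decompositionTree (by omega) rfl, fun l hl => by omega, fun l hl => ?_⟩
    obtain rfl : k = l := by omega
    exact Hendry.pasted_inFamilyJ (by omega)
  · have hk : 3 ≤ k := by omega
    have hham := Hendry.pasted_isHamiltonian (ε := false) hk
    refine ⟨_, inferInstance, inferInstance, Hendry.pasted k false, hham.connected, hham,
      Hendry.pasted_isChordal, Hendry.pasted_not_isCycleExtendible hk,
      Hendry.pasted_exists_decompositionTree (by omega) rfl, fun l hl => ?_, fun l hl => by omega⟩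
    obtain rfl : k = l := by omega
    exact Hendry.pasted_inFamilyH
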